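/- \textbf{Setting.} Let $M$ be a smooth $n$-dimensional manifold with a sub-Riemannian structure $(\mathcal D,g)$: $\mathcal D\subseteq TM$ is a smooth bracket-generating sub-bundle and $g$ a smooth scalar product on $\mathcal D$. Let $\pi:T^*M\to M$ be the projection, $\theta$ the Liouville one-form, $\sigma=d\theta$, and let $H(\lambda)=\frac12\sum_i\langle\lambda,X_i\rangle^2$ ($X_1,\dots,X_k$ a local orthonormal frame of $\mathcal D$) be the Hamiltonian, with Hamiltonian vector field $\vec H$ given by $\sigma(\cdot,\vec H)=dH$. An extremal with initial covector $\lambda$ is the integral curve $\lambda(t)=e^{t\vec H}(\lambda)$, on an open interval $J\ni 0$; its projection is the geodesic $\gamma(t)=\pi(\lambda(t))$. For a vector field $V(t)$ along $\lambda(t)$ set $\dot V(t)=\frac{d}{d\varepsilon}\big|_{\varepsilon=0}(e^{-\varepsilon\vec H})_*V(t+\varepsilon)$. For $c>0$ let $P_c:T^*M\to T^*M$, $P_c(\lambda)=c\lambda$, be the fiberwise dilation. \textbf{Young diagram.} For $i\ge1$ let $\mathcal F^i_{\gamma(t)}=\mathrm{span}\{\mathcal L_T^jX|_{\gamma(t)}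 : X\in\Gamma(\mathcal D),\ j\le i-1\}$, where $T\in\Gamma(\mathcal D)$ extends $\dot\gamma$ near time $t$ (the choice does not matter), and $\mathcal F^0=0$. The geodesic is equiregular if every $\dim\mathcal F^i_{\gamma(t)}$ is independent of $t$, and ample if for every $t$ some $\mathcal F^m_{\gamma(t)}$ is $T_{\gamma(t)}M$. Its Young diagram $D$ then has $i$-th column of length $\dim\mathcal F^i-\dim\mathcal F^{i-1}$. Its boxes are written $ai\in D$, with $a$ the row and $i=1,\dots,n_a$ the position in the row, $n_a$ being the length of row $a$. \textbf{Canonical frame.} Let $\lambda(t)$ be an extremal whose geodesic is ample and equiregular with Young diagram $D$. A smooth moving frame $\{E_{ai}(t),F_{ai}(t)\}_{ai\in D}$ of $T_{\lambda(t)}(T^*M)$ is \emph{canonical} with curvature matrix $R(t)=(R_{ai,bj}(t))$, a smooth family of matrices, if (i) $\pi_*E_{ai}=0$; (ii) $\sigma(E_{ai},E_{bj})=\sigma(F_{ai},F_{bj})=0$ and $\sigma(E_{ai},F_{bj})=\delta_{ab}\delta_{ij}$; (iii) $\dot E_{ai}=E_{a(i-1)}$ for $i\ge2$; $\dot E_{a1}=-F_{a1}$;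 $\dot F_{ai}=\sum_{bj}R_{ai,bj}(t)E_{bj}-F_{a(i+1)}$ for $i<n_a$; $\dot F_{an_a}=\sum_{bj}R_{an_a,bj}(t)E_{bj}$; and $R(t)$ is normal, that is: $R_{ai,bj}=R_{bj,ai}$; $R_{ai,b(i+1)}=-R_{bi,a(i+1)}$ if $n_a=n_b$ and $i<n_a$; if $n_a=n_b$ and $R_{ai,bj}\ne0$ then $|i-j|\le1$; and if $n_a>n_b$ and $R_{ai,bj}\neq0$ then $(i,j)$ is among the last $2n_b$ terms of the sequence of $n_a+n_b-1$ pairs $(1,1),(1,2),(2,2),(2,3),\dots,(n_b,n_b),(n_b+1,n_b),\dots,(n_a,n_b)$. \textbf{Proposition.} Let $\lambda\in T^*M$ with $H(\lambda)=\frac12$, let the geodesic of the extremal $\lambda(t)$ be ample and equiregular with Young diagram $D$, and let $\{E_{ai},F_{ai}\}_{ai\in D}$ be a canonical frame along $\lambda(t)$, $t\in J$, with curvature matrix $R^\lambda(t)$. Let $c>0$ and define, for $ct\in J$ and $ai\in D$, $$E^c_{ai}(t)=\frac1{c^i}\,(d_{\lambda(ct)}P_c)E_{ai}(ct),\qquad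 F^c_{ai}(t)=c^{i-1}(d_{\lambda(ct)}P_c)F_{ai}(ct).$$ Then $H(c\lambda)=\frac{c^2}2$; the extremal with initial covector $c\lambda$ is $\lambda^c(t)=c\,\lambda(ct)$, and its geodesic is ample and equiregular with the same Young diagram $D$; and $\{E^c_{ai},F^c_{ai}\}_{ai\in D}$ is a canonical frame along $\lambda^c(t)$, with curvature matrix $$R^{c\lambda}_{ai,bj}(t)=c^{i+j}R^\lambda_{ai,bj}(ct).$$ -/

import Mathlib

open Bundle Set Filter
open scoped Manifold ContDiff Topology

noncomputable section

namespace SubRiem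

/-! ### The cotangent bundle -/

/-- The model space `ℝⁿ`. -/
abbrev Model (n : ℕ) : Type := EuclideanSpace ℝ (Fin n)

/-- The model space `ℝⁿ × (ℝⁿ)*` of the cotangent bundle of an `n`-dimensional manifold. -/
abbrev CotModel (n : ℕ) : Type := Model n × (Model n →L[ℝ] ℝ)

/-- The model with corners (without boundary) of the cotangent bundle. -/
abbrev cotI (n : ℕ) : ModelWithCorners ℝ (CotModel n) (ModelProd (Model n) (Model n →L[ℝ] ℝ)) :=
  (𝓡 n).prod 𝓘(ℝ, Model n →L[ℝ] ℝ)

/-- The cotangent bundle `T*M`, the bundle of continuous linear functionals on the tangent spaces.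
A point `q` has a base point `q.proj` and a covector `q.snd : T_{q.proj} M →L[ℝ] ℝ`. -/
abbrev CotangentBundle (n : ℕ) (M : Type*) [TopologicalSpace M] [ChartedSpace (Model n) M] :=
  TotalSpace (Model n →L[ℝ] ℝ) (fun x : M => TangentSpace (𝓡 n) x →L[ℝ] ℝ)

section Cotangent

variable {n : ℕ} {M : Type*} [TopologicalSpace M] [ChartedSpace (Model n) M]

/-- Fiberwise dilation `P_c`, `λ ↦ c λ`. -/
def dilation (c : ℝ) (q : CotangentBundle n M) : CotangentBundle n M := ⟨q.proj, c • q.snd⟩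

variable [IsManifold (𝓡 n) ∞ M]

/-- The differential `π_*` at `q` of the projection `π : T*M → M`. -/
def dproj (q : CotangentBundle n M) :
    TangentSpace (cotI n) q →L[ℝ] TangentSpace (𝓡 n) q.proj :=
  mfderiv (cotI n) (𝓡 n) (fun p : CotangentBundle n M => p.proj) q

/-- The Liouville one-form `θ_q(ξ) = ⟨q, π_* ξ⟩`. -/
def liouville (q : CotangentBundle n M) : TangentSpace (cotI n) q →L[ℝ] ℝ :=
  q.snd.comp (dproj q)

/-- The expression, in the chart of `T*M` around `q`, of the Liouville one-form. -/
def liouvilleInChart (q : CotangentBundle n M) (z : CotModel n) : CotModel n →L[ℝ] ℝ :=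
  (liouville ((extChartAt (cotI n) q).symm z)).comp
    (mfderiv 𝓘(ℝ, CotModel n) (cotI n) (extChartAt (cotI n) q).symm z)

/-- The differential at `q` of the chart of `T*M` around `q`. -/
def dchart (q : CotangentBundle n M) : TangentSpace (cotI n) q →L[ℝ] CotModel n :=
  mfderiv (cotI n) 𝓘(ℝ, CotModel n) (extChartAt (cotI n) q) q

/-- The canonical symplectic form `σ = dθ` on `T*M`. The exterior derivative is computed in the
chart around the base point, where `dω(ξ, η) = (D_ξ ω)(η) - (D_η ω)(ξ)`. -/
def sympl (q : CotangentBundle n M) (ξ η : TangentSpace (cotI n) q) : ℝ :=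
  fderiv ℝ (liouvilleInChart q) (extChartAt (cotI n) q q) (dchart q ξ) (dchart q η) -
    fderiv ℝ (liouvilleInChart q) (extChartAt (cotI n) q q) (dchart q η) (dchart q ξ)

end Cotangent

/-! ### Sub-Riemannian structures -/

section Structures

variable {n : ℕ} {M : Type*} [TopologicalSpace M] [ChartedSpace (Model n) M]

/-- `X` is a smooth (global) vector field with values in the family of subspaces `D`, that is,
`X ∈ Γ(D)` when `D` is a sub-bundle of `TM`. -/
def IsSectionOf [IsManifold (𝓡 n) ∞ M] (D : ∀ x : M, Submodule ℝ (TangentSpace (𝓡 n) x))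
    (X : ∀ x : M, TangentSpace (𝓡 n) x) : Prop :=
  ContMDiff (𝓡 n) (𝓡 n).tangent ∞ (fun x => (⟨x, X x⟩ : TangentBundle (𝓡 n) M)) ∧
    ∀ x, X x ∈ D x

/-- The iterated Lie brackets of sections of `D`. -/
inductive IsIteratedBracket [IsManifold (𝓡 n) ∞ M]
    (D : ∀ x : M, Submodule ℝ (TangentSpace (𝓡 n) x)) : (∀ x : M, TangentSpace (𝓡 n) x) → Prop
  | of_section (X : ∀ x : M, TangentSpace (𝓡 n) x) (hX : IsSectionOf D X) :
      IsIteratedBracket D X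
  | bracket (X Y : ∀ x : M, TangentSpace (𝓡 n) x) (hX : IsIteratedBracket D X)
      (hY : IsIteratedBracket D Y) :
      IsIteratedBracket D (VectorField.mlieBracket (𝓡 n) X Y)

end Structures

/-- A sub-Riemannian structure `(D, g)` on the smooth `n`-dimensional manifold `M`: a smooth,
completely non-integrable (bracket-generating) vector sub-bundle `D` of `TM`, with a smooth scalar
product `g` on `D`. -/
structure SubRiemannianStructure (n : ℕ) (M : Type*) [TopologicalSpace M]
    [ChartedSpace (Model n) M] [IsManifold (𝓡 n) ∞ M] where
  /-- the rank of the distribution -/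
  rank : ℕ
  /-- the distribution -/
  D : ∀ x : M, Submodule ℝ (TangentSpace (𝓡 n) x)
  finrank_D : ∀ x, Module.finrank ℝ (D x) = rank
  /-- `D` has smooth local frames -/
  smooth_D : ∀ x : M, ∃ U : Set M, IsOpen U ∧ x ∈ U ∧
    ∃ X : Fin rank → ∀ y : M, TangentSpace (𝓡 n) y,
      (∀ i, ContMDiffOn (𝓡 n) (𝓡 n).tangent ∞
        (fun y => (⟨y, X i y⟩ : TangentBundle (𝓡 n) M)) U) ∧
      ∀ y ∈ U, Submodule.span ℝ (range fun i => X i y) = D y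
  /-- iterated brackets of sections of `D` span the tangent spaces -/
  bracketGenerating : ∀ x : M,
    Submodule.span ℝ {v | ∃ X, IsIteratedBracket D X ∧ X x = v} = ⊤
  /-- the scalar product on the distribution -/
  g : ∀ x : M, LinearMap.BilinForm ℝ (D x)
  g_symm : ∀ x v w, g x v w = g x w v
  g_pos : ∀ x v, v ≠ 0 → 0 < g x v v
  /-- `g(X, Y)` is a smooth function for all `X, Y ∈ Γ(D)` -/
  smooth_g : ∀ (X Y : ∀ x : M, TangentSpace (𝓡 n) x)
    (hX : IsSectionOf D X) (hY : IsSectionOf D Y),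
    ContMDiff (𝓡 n) 𝓘(ℝ, ℝ) ∞ (fun x => g x ⟨X x, hX.2 x⟩ ⟨Y x, hY.2 x⟩)

namespace SubRiemannianStructure

variable {n : ℕ} {M : Type*} [TopologicalSpace M] [ChartedSpace (Model n) M]
  [IsManifold (𝓡 n) ∞ M] (S : SubRiemannianStructure n M)

/-! ### The Hamiltonian, its extremals and its flow -/

theorem exists_orthonormal (x : M) :
    ∃ X : Fin S.rank → S.D x, ∀ i j, S.g x (X i) (X j) = if i = j then 1 else 0 := by
  have hf := S.finrank_D x
  let core : InnerProductSpace.Core ℝ (S.D x) :=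
    { inner := fun v w => S.g x v w
      conj_inner_symm := fun v w => by simpa using S.g_symm x w v
      re_inner_nonneg := fun v => by
        by_cases hv : v = 0
        · simp [hv]
        · simpa using (S.g_pos x v hv).le
      add_left := fun u v w => by simp
      smul_left := fun v w r => by simp
      definite := fun v hv => by
        by_contra h
        exact (S.g_pos x v h).ne' hv }
  let _ : NormedAddCommGroup (S.D x) := core.toNormedAddCommGroup
  let _ : InnerProductSpace ℝ (S.D x) := InnerProductSpace.ofCore core.toCore
  have : FiniteDimensional ℝ (TangentSpace (𝓡 n) x) :=
    inferInstanceAs (FiniteDimensional ℝ (Model n))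
  let b := (stdOrthonormalBasis ℝ (S.D x)).reindex (finCongr hf)
  exact ⟨fun i => b i, fun i j => orthonormal_iff_ite.mp b.orthonormal i j⟩

/-- An orthonormal basis of `(D_x, g_x)`. -/
def orthonormalBasisAt (x : M) : Fin S.rank → S.D x := (S.exists_orthonormal x).choose

/-- The sub-Riemannian Hamiltonian `H(λ) = ½ ∑ᵢ ⟨λ, Xᵢ⟩²`, where `X₁, …, X_k` is an orthonormal
basis of `D` at the base point of `λ` (the sum does not depend on the basis). -/
def hamiltonian (q : CotangentBundle n M) : ℝ :=
  (1 / 2) * ∑ i, (q.snd (S.orthonormalBasisAt q.proj i : TangentSpace (𝓡 n) q.proj)) ^ 2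

/-- The level set `{H = s / 2}`; the unit cotangent bundle is the case `s = 1`. -/
def levelSet (s : ℝ) : Set (CotangentBundle n M) := {q | S.hamiltonian q = s / 2}

/-- `v` is the value at `q` of the Hamiltonian vector field of `H`, the vector field that is
defined by `σ(·, H⃗) = dH`. -/
def IsHamiltonianVector (q : CotangentBundle n M) (v : TangentSpace (cotI n) q) : Prop :=
  ∀ ξ : TangentSpace (cotI n) q, sympl q ξ v = mfderiv (cotI n) 𝓘(ℝ, ℝ) S.hamiltonian q ξ

/-- `lam` is, on the open set `J` of times, an integral curve of the Hamiltonian vector field. -/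
def IsExtremalOn (lam : ℝ → CotangentBundle n M) (J : Set ℝ) : Prop :=
  ∀ t ∈ J, ∃ v : TangentSpace (cotI n) (lam t),
    HasMFDerivAt 𝓘(ℝ, ℝ) (cotI n) lam t ((1 : ℝ →L[ℝ] ℝ).smulRight v) ∧
      S.IsHamiltonianVector (lam t) v

/-- `Φ s q = e^{s H⃗}(q)` is the (smooth) local flow of the Hamiltonian vector field, for initial
points in the open set `U` and times `|s| < δ`. -/
structure IsLocalFlow (δ : ℝ) (U : Set (CotangentBundle n M))
    (Φ : ℝ → CotangentBundle n M → CotangentBundle n M) : Prop where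
  pos : 0 < δ
  isOpen : IsOpen U
  map_zero : ∀ q ∈ U, Φ 0 q = q
  integral : ∀ q ∈ U, S.IsExtremalOn (fun s => Φ s q) (Ioo (-δ) δ)
  smooth : ContMDiffOn (𝓘(ℝ, ℝ).prod (cotI n)) (cotI n) ∞
    (fun z : ℝ × CotangentBundle n M => Φ z.1 z.2) (Ioo (-δ) δ ×ˢ U)

/-- The vector field `V` along the extremal `lam` has, at time `t`, the Lie derivative
`V̇(t) = d/dε|_{ε=0} (e^{-εH⃗})_* V(t+ε)` equal to `W`. All the vectors `(e^{-εH⃗})_* V(t+ε)` are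
tangent to `T*M` at the same point `e^{-εH⃗}(lam (t+ε)) = lam t`, so the derivative is one of a
curve in a fixed vector space (the tangent space, which is identified with the model space by the
chart around that point). -/
def HasDot (lam : ℝ → CotangentBundle n M) (V : ∀ t : ℝ, TangentSpace (cotI n) (lam t)) (t : ℝ)
    (W : TangentSpace (cotI n) (lam t)) : Prop :=
  ∃ (δ : ℝ) (U : Set (CotangentBundle n M))
    (Φ : ℝ → CotangentBundle n M → CotangentBundle n M),
    S.IsLocalFlow δ U Φ ∧ lam t ∈ U ∧
    HasDerivAt (F := CotModel n)
      (fun ε : ℝ =>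
        (mfderiv (cotI n) (cotI n) (Φ (-ε)) (lam (t + ε)) (V (t + ε)) : CotModel n))
      W 0

/-! ### Geodesic flag, ample and equiregular geodesics -/

/-- The flag `F^i` at time `t` of the geodesic `γ`: the span of the vectors `L_T^j X` at `γ(t)`,
for `X ∈ Γ(D)`, `j ≤ i - 1`, where `T ∈ Γ(D)` extends the tangent vector field of `γ` near time
`t`. (The values do not depend on the extension. By convention `F^0 = 0`.) -/
def flag (γ : ℝ → M) (t : ℝ) (i : ℕ) : Submodule ℝ (TangentSpace (𝓡 n) (γ t)) :=
  Submodule.span ℝ {v | ∃ T X : ∀ x : M, TangentSpace (𝓡 n) x,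
    IsSectionOf S.D T ∧ IsSectionOf S.D X ∧
    (∀ᶠ s in 𝓝 t, T (γ s) = mfderiv 𝓘(ℝ, ℝ) (𝓡 n) γ s (1 : ℝ)) ∧
    ∃ j < i, v = ((fun Y => VectorField.mlieBracket (𝓡 n) T Y)^[j] X) (γ t)}

/-- The dimensions of the flag of `γ` do not depend on the time. -/
def IsEquiregular (γ : ℝ → M) (J : Set ℝ) : Prop :=
  ∀ i ≥ 1, ∀ s ∈ J, ∀ t ∈ J,
    Module.finrank ℝ (S.flag γ s i) = Module.finrank ℝ (S.flag γ t i)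

/-- At each time, the flag of `γ` reaches the whole tangent space. -/
def IsAmple (γ : ℝ → M) (J : Set ℝ) : Prop :=
  ∀ t ∈ J, ∃ m ≥ 1, Module.finrank ℝ (S.flag γ t m) = n

/-- The length of the `i`-th column of `y` is `dim F^i - dim F^{i-1}`, for all `i ≥ 1`. Columns in
Mathlib are counted from `0`. -/
def HasYoungDiagram (γ : ℝ → M) (J : Set ℝ) (y : YoungDiagram) : Prop :=
  ∀ t ∈ J, ∀ i : ℕ,
    Module.finrank ℝ (S.flag γ t (i + 1)) = Module.finrank ℝ (S.flag γ t i) + y.colLen i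

end SubRiemannianStructure

/-! ### Young diagrams and normal matrices -/

/-- The boxes of a Young diagram. -/
abbrev Box (y : YoungDiagram) : Type := {p : ℕ × ℕ // p ∈ y.cells}

namespace Box

variable {y : YoungDiagram}

/-- The row `a` of the box `ai` (only used as a label). -/
def row (p : Box y) : ℕ := p.1.1

/-- The position `i = 1, …, n_a` of the box `ai` in its row. -/
def col (p : Box y) : ℕ := p.1.2 + 1

/-- The length `n_a` of the row of the box `ai`. -/
def len (p : Box y) : ℕ := y.rowLen p.1.1

end Box

/-- The sequence of pairs `(i, j)` (for a given `n_b`) that starts from `(1,1)`, continues with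
`(1,2), (2,2), (2,3), …` up to `(n_b, n_b)` and then increases `i` only. The first `n_a + n_b - 1`
of its terms end with `(n_a, n_b)`. -/
def normalTable (nb : ℕ) : ℕ → ℕ × ℕ
  | 0 => (1, 1)
  | s + 1 =>
    let p := normalTable nb s
    if p.2 < nb ∧ p.1 = p.2 then (p.1, p.2 + 1) else (p.1 + 1, p.2)

/-- The normal condition for a matrix indexed by the boxes of a Young diagram. -/
structure IsNormal {y : YoungDiagram} (R : Matrix (Box y) (Box y) ℝ) : Prop where
  symm : ∀ p q, R p q = R q p
  /-- `R_{ai,b(i+1)} = - R_{bi,a(i+1)}` if `n_a = n_b` and `i < n_a`; here `p = ai`, `q = bi`,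
  `p' = a(i+1)`, `q' = b(i+1)` -/
  skew : ∀ p q p' q' : Box y, p.len = q.len → p.col = q.col →
    p'.row = p.row → q'.row = q.row → p'.col = p.col + 1 → q'.col = q.col + 1 →
    R p q' = - R q p'
  /-- the entries between rows of the same length -/
  vanish_eq : ∀ p q : Box y, p.len = q.len → R p q ≠ 0 → p.col ≤ q.col + 1 ∧ q.col ≤ p.col + 1
  /-- if `n_a > n_b`, an entry can be non-zero only at the last `2 n_b` among the `n_a + n_b - 1`
  pairs of the table (the case `n_a < n_b` follows by symmetry) -/
  vanish_gt : ∀ p q : Box y, q.len < p.len → R p q ≠ 0 →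
    ∃ s < p.len + q.len - 1, p.len + q.len - 1 ≤ s + 2 * q.len ∧
      (p.col, q.col) = normalTable q.len s

/-! ### Canonical frames -/

/-- `{E_{ai}, F_{ai}}` is a canonical frame, with curvature matrix `R`, along the extremal
`lam`, defined on the open interval `J ∋ 0`, with initial covector `q₀`, where `y` is the Young
diagram of the corresponding (ample and equiregular) geodesic. -/
structure IsCanonicalFrame {n : ℕ} {M : Type*} [TopologicalSpace M] [ChartedSpace (Model n) M]
    [IsManifold (𝓡 n) ∞ M] (S : SubRiemannianStructure n M) (q₀ : CotangentBundle n M)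
    (J : Set ℝ) (lam : ℝ → CotangentBundle n M) (y : YoungDiagram)
    (E F : Box y → ∀ t : ℝ, TangentSpace (cotI n) (lam t))
    (R : ℝ → Matrix (Box y) (Box y) ℝ) : Prop where
  isOpen : IsOpen J
  ordConnected : J.OrdConnected
  zero_mem : (0 : ℝ) ∈ J
  initial : lam 0 = q₀
  extremal : S.IsExtremalOn lam J
  ample : S.IsAmple (fun t => (lam t).proj) J
  equiregular : S.IsEquiregular (fun t => (lam t).proj) J
  young : S.HasYoungDiagram (fun t => (lam t).proj) J y
  /-- a smooth moving frame along the extremal -/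
  smooth_E : ∀ p, ContMDiffOn 𝓘(ℝ, ℝ) (cotI n).tangent ∞
    (fun t => (⟨lam t, E p t⟩ : TangentBundle (cotI n) (CotangentBundle n M))) J
  smooth_F : ∀ p, ContMDiffOn 𝓘(ℝ, ℝ) (cotI n).tangent ∞
    (fun t => (⟨lam t, F p t⟩ : TangentBundle (cotI n) (CotangentBundle n M))) J
  linearIndependent : ∀ t ∈ J,
    LinearIndependent ℝ (Sum.elim (fun p => E p t) (fun p => F p t))
  span_eq_top : ∀ t ∈ J,
    Submodule.span ℝ (range (Sum.elim (fun p => E p t) (fun p => F p t))) = ⊤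
  /-- (i) the `E`'s are vertical -/
  vertical : ∀ p, ∀ t ∈ J, dproj (lam t) (E p t) = 0
  /-- (ii) the frame is Darboux -/
  darboux_EE : ∀ p q, ∀ t ∈ J, sympl (lam t) (E p t) (E q t) = 0
  darboux_FF : ∀ p q, ∀ t ∈ J, sympl (lam t) (F p t) (F q t) = 0
  darboux_EF : ∀ p q, ∀ t ∈ J, sympl (lam t) (E p t) (F q t) = if p = q then 1 else 0
  /-- (iii) structural equations: `Ė_{ai} = E_{a(i-1)}` for `i ≥ 2` (`p = ai`, `p' = a(i-1)`) -/
  dot_E : ∀ p p' : Box y, p'.row = p.row → p.col = p'.col + 1 → ∀ t ∈ J,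
    S.HasDot lam (E p) t (E p' t)
  /-- `Ė_{a1} = - F_{a1}` -/
  dot_E_one : ∀ p : Box y, p.col = 1 → ∀ t ∈ J, S.HasDot lam (E p) t (-(F p t))
  /-- `Ḟ_{ai} = ∑ R_{ai,bj} E_{bj} - F_{a(i+1)}` for `i < n_a` (`p = ai`, `p' = a(i+1)`) -/
  dot_F : ∀ p p' : Box y, p'.row = p.row → p'.col = p.col + 1 → ∀ t ∈ J,
    S.HasDot lam (F p) t ((∑ q, R t p q • E q t) - F p' t)
  /-- `Ḟ_{a n_a} = ∑ R_{a n_a,bj} E_{bj}` -/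
  dot_F_last : ∀ p : Box y, p.col = p.len → ∀ t ∈ J,
    S.HasDot lam (F p) t (∑ q, R t p q • E q t)
  /-- the curvature matrix is smooth in time and normal (in particular symmetric) -/
  smooth_R : ∀ p q, ContDiffOn ℝ ∞ (fun t => R t p q) J
  normal : ∀ t ∈ J, IsNormal (R t)

end SubRiem

end

/-!
The dilation satisfies `P_c^* θ = c θ`, hence `P_c^* σ = c σ`, while `H ∘ P_c = c² H`. Therefore
`H⃗ ∘ P_c = c (P_c)_* H⃗`, that is, `e^{s H⃗} ∘ P_c = P_c ∘ e^{c s H⃗}`: the curve `t ↦ c λ(ct)` is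
an extremal, and transporting a field `V` along `λ` to `t ↦ (P_c)_* V(ct)` multiplies its
dot-derivative by `c`. The weights `c^{-i}` of `E_{ai}` and `c^{i-1}` of `F_{ai}` absorb this factor
in the structural equations, and their product `c^{-1}` compensates `P_c^* σ = c σ` in the Darboux
relations.
-/

noncomputable section

namespace SubRiem

section Manifold

variable {𝕜 : Type*} [NontriviallyNormedField 𝕜]
  {E₁ : Type*} [NormedAddCommGroup E₁] [NormedSpace 𝕜 E₁]
  {E₂ : Type*} [NormedAddCommGroup E₂] [NormedSpace 𝕜 E₂]
  {E₃ : Type*} [NormedAddCommGroup E₃] [NormedSpace 𝕜 E₃]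
  {H₁ : Type*} [TopologicalSpace H₁] {H₂ : Type*} [TopologicalSpace H₂]
  {H₃ : Type*} [TopologicalSpace H₃]
  {I₁ : ModelWithCorners 𝕜 E₁ H₁} {I₂ : ModelWithCorners 𝕜 E₂ H₂} {I₃ : ModelWithCorners 𝕜 E₃ H₃}
  {M₁ : Type*} [TopologicalSpace M₁] [ChartedSpace H₁ M₁]
  {M₂ : Type*} [TopologicalSpace M₂] [ChartedSpace H₂ M₂]
  {M₃ : Type*} [TopologicalSpace M₃] [ChartedSpace H₃ M₃] {k : ℕ∞ω}

theorem mfderiv_comp_diffeomorph (f : M₂ → M₃) (e : M₁ ≃ₘ^k⟮I₁, I₂⟯ M₂) (hk : k ≠ 0) (x : M₁) :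
    mfderiv I₁ I₃ (f ∘ e) x = (mfderiv I₂ I₃ f (e x)).comp (mfderiv I₁ I₂ e x) := by
  by_cases hf : MDifferentiableAt I₂ I₃ f (e x)
  · exact mfderiv_comp x hf (e.mdifferentiable hk x)
  · have hfe : ¬ MDifferentiableAt I₁ I₃ (f ∘ e) x := fun h => hf <| by
      have := MDifferentiableAt.comp_of_eq (e x) h (e.symm.mdifferentiable hk (e x))
        (e.symm_apply_apply x)
      simpa only [Function.comp_def, e.apply_symm_apply] using this
    rw [mfderiv_zero_of_not_mdifferentiableAt hf, mfderiv_zero_of_not_mdifferentiableAt hfe,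
      ContinuousLinearMap.zero_comp]

theorem mfderiv_diffeomorph_comp (e : M₂ ≃ₘ^k⟮I₂, I₃⟯ M₃) (f : M₁ → M₂) (hk : k ≠ 0) (x : M₁) :
    mfderiv I₁ I₃ (e ∘ f) x = (mfderiv I₂ I₃ e (f x)).comp (mfderiv I₁ I₂ f x) := by
  by_cases hf : MDifferentiableAt I₁ I₂ f x
  · exact mfderiv_comp x (e.mdifferentiable hk (f x)) hf
  · have hef : ¬ MDifferentiableAt I₁ I₃ (e ∘ f) x := fun h => hf <| by
      have := (e.symm.mdifferentiable hk (e (f x))).comp x h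
      simpa only [Function.comp_def, e.symm_apply_apply] using this
    rw [mfderiv_zero_of_not_mdifferentiableAt hf, mfderiv_zero_of_not_mdifferentiableAt hef,
      ContinuousLinearMap.comp_zero]

theorem mfderiv_conj_diffeomorph (e : M₁ ≃ₘ^k⟮I₁, I₂⟯ M₂) (f : M₁ → M₁) (hk : k ≠ 0) (x : M₁) :
    (mfderiv I₂ I₂ (e ∘ f ∘ e.symm) (e x)).comp (mfderiv I₁ I₂ e x) =
      (mfderiv I₁ I₂ e (f x)).comp (mfderiv I₁ I₁ f x) := by
  have hconj : (e ∘ f ∘ e.symm) ∘ e = e ∘ f := by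
    simp only [Function.comp_def, e.symm_apply_apply]
  exact (mfderiv_comp_diffeomorph _ e hk x).symm.trans
    (hconj ▸ mfderiv_diffeomorph_comp e f hk x)

theorem hasMFDerivAt_extChartAt_self (x : M₁) :
    HasMFDerivAt I₁ 𝓘(𝕜, E₁) (extChartAt I₁ x) x (ContinuousLinearMap.id 𝕜 E₁) := by
  have hright : ∀ᶠ z in 𝓝[range I₁] (extChartAt I₁ x x),
      extChartAt I₁ x ((extChartAt I₁ x).symm z) = z :=
    mem_of_superset (extChartAt_target_mem_nhdsWithin x) fun _ => (extChartAt I₁ x).right_inv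
  exact ⟨continuousAt_extChartAt x, (hasFDerivWithinAt_id _ _).congr_of_eventuallyEq hright
    (congrArg (extChartAt I₁ x) (extChartAt_to_inv x))⟩

theorem mfderiv_const_smul (f : M₁ → E₂) (a : 𝕜) (x : M₁) :
    mfderiv I₁ 𝓘(𝕜, E₂) (a • f) x = a • mfderiv I₁ 𝓘(𝕜, E₂) f x := by
  rcases eq_or_ne a 0 with rfl | ha
  · rw [zero_smul]
    exact mfderiv_const.trans (zero_smul 𝕜 (mfderiv I₁ 𝓘(𝕜, E₂) f x)).symm
  · let L := ContinuousLinearEquiv.smulLeft (R₁ := 𝕜) (M₁ := E₂) (Units.mk0 a ha)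
    exact (mfderiv_diffeomorph_comp L.toDiffeomorph f (by simp) x).trans
      (congrArg (ContinuousLinearMap.comp · (mfderiv I₁ 𝓘(𝕜, E₂) f x)) L.mfderiv_eq)

theorem mfderiv_comp_mul_left (γ : 𝕜 → M₁) {c : 𝕜} (hc : c ≠ 0) (t : 𝕜) :
    mfderiv 𝓘(𝕜, 𝕜) I₁ (fun s => γ (c * s)) t (1 : 𝕜) =
      c • mfderiv 𝓘(𝕜, 𝕜) I₁ γ (c * t) (1 : 𝕜) := by
  let L := ContinuousLinearEquiv.smulLeft (R₁ := 𝕜) (M₁ := 𝕜) (Units.mk0 c hc)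
  have hchain := DFunLike.congr_fun
    (mfderiv_comp_diffeomorph (I₃ := I₁) γ L.toDiffeomorph (by simp) t) (1 : 𝕜)
  have hL : mfderiv 𝓘(𝕜, 𝕜) 𝓘(𝕜, 𝕜) L t (1 : 𝕜) = c • (1 : 𝕜) :=
    DFunLike.congr_fun L.mfderiv_eq (1 : 𝕜)
  exact hchain.trans ((congrArg (mfderiv 𝓘(𝕜, 𝕜) I₁ γ (c * t)) hL).trans
    ((mfderiv 𝓘(𝕜, 𝕜) I₁ γ (c * t)).map_smul c (1 : 𝕜)))

end Manifold

section Bundle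

variable {𝕜 : Type*} [NontriviallyNormedField 𝕜]
  {EN HN N : Type*} [NormedAddCommGroup EN] [NormedSpace 𝕜 EN] [TopologicalSpace HN]
  {IN : ModelWithCorners 𝕜 EN HN} [TopologicalSpace N] [ChartedSpace HN N]
  {EB HB B : Type*} [NormedAddCommGroup EB] [NormedSpace 𝕜 EB] [TopologicalSpace HB]
  {IB : ModelWithCorners 𝕜 EB HB} [TopologicalSpace B] [ChartedSpace HB B]
  {F : Type*} [NormedAddCommGroup F] [NormedSpace 𝕜 F]
  {Z : B → Type*} [TopologicalSpace (TotalSpace F Z)] [∀ x, TopologicalSpace (Z x)]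
  [∀ x, AddCommGroup (Z x)] [∀ x, Module 𝕜 (Z x)] [FiberBundle F Z] [VectorBundle 𝕜 F Z]

theorem contMDiffOn_const_smul_totalSpace {k : ℕ∞ω} {s : Set N} {f : N → B} {V : ∀ x, Z (f x)}
    (hV : ContMDiffOn IN (IB.prod 𝓘(𝕜, F)) k (fun x => (⟨f x, V x⟩ : TotalSpace F Z)) s) (a : 𝕜) :
    ContMDiffOn IN (IB.prod 𝓘(𝕜, F)) k (fun x => (⟨f x, a • V x⟩ : TotalSpace F Z)) s := by
  intro x hx
  let e := trivializationAt F Z (f x)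
  obtain ⟨hf, hVe⟩ := Bundle.contMDiffWithinAt_totalSpace.1 (hV x hx)
  refine Bundle.contMDiffWithinAt_totalSpace.2 ⟨hf, ?_⟩
  have hlin : ∀ z, f z ∈ e.baseSet → (e ⟨f z, a • V z⟩).2 = a • (e ⟨f z, V z⟩).2 :=
    fun z hz => (e.linear 𝕜 hz).map_smul a (V z)
  have hxe : f x ∈ e.baseSet := FiberBundle.mem_baseSet_trivializationAt' (f x)
  have hsmul : ContMDiffWithinAt IN 𝓘(𝕜, F) k (fun z => a • (e ⟨f z, V z⟩).2) s x :=
    (contMDiffWithinAt_const (I' := 𝓘(𝕜, 𝕜)) (c := a)).smul hVe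
  exact hsmul.congr_of_eventuallyEq
    ((hf.continuousWithinAt.eventually_mem (e.open_baseSet.mem_nhds hxe)).mono hlin) (hlin x hxe)

end Bundle

theorem fderiv_oneForm_comp_equiv {V : Type*} [NormedAddCommGroup V] [NormedSpace ℝ V]
    (L : V ≃L[ℝ] V) (c : ℝ) (α : V → V →L[ℝ] ℝ) (z : V)
    (h : ∀ᶠ w in 𝓝 z, ∀ v, α (L w) (L v) = c * α w v) (ξ η : V) :
    fderiv ℝ α (L z) (L ξ) (L η) = c * fderiv ℝ α z ξ η := by
  let T : (V →L[ℝ] ℝ) ≃L[ℝ] (V →L[ℝ] ℝ) :=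
    L.symm.arrowCongr (ContinuousLinearEquiv.refl ℝ ℝ)
  have hT : T ∘ α ∘ L =ᶠ[𝓝 z] c • α := by
    filter_upwards [h] with w hw using ContinuousLinearMap.ext hw
  have hfderiv := hT.fderiv_eq (𝕜 := ℝ)
  rw [T.comp_fderiv, L.comp_right_fderiv, fderiv_const_smul_field (R := ℝ) (f := α) c] at hfderiv
  exact DFunLike.congr_fun (DFunLike.congr_fun hfderiv ξ) η

section Dilation

/-- The expression `(x, p) ↦ (x, c p)` of `P_c` in the charts of the cotangent bundle, which is also
that of its differential. -/
def modelDilation (n : ℕ) {c : ℝ} (hc : c ≠ 0) : CotModel n ≃L[ℝ] CotModel n :=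
  (ContinuousLinearEquiv.refl ℝ (Model n)).prodCongr
    (ContinuousLinearEquiv.smulLeft (Units.mk0 c hc))

variable {n : ℕ} {M : Type*} [TopologicalSpace M] [ChartedSpace (Model n) M]

theorem dilation_inv_dilation {c : ℝ} (hc : c ≠ 0) (q : CotangentBundle n M) :
    dilation c⁻¹ (dilation c q) = q :=
  congrArg (TotalSpace.mk q.proj) (inv_smul_smul₀ hc q.snd)

theorem dilation_dilation_inv {c : ℝ} (hc : c ≠ 0) (q : CotangentBundle n M) :
    dilation c (dilation c⁻¹ q) = q :=
  congrArg (TotalSpace.mk q.proj) (smul_inv_smul₀ hc q.snd)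

variable [IsManifold (𝓡 n) ∞ M]

theorem contMDiff_dilation (c : ℝ) :
    ContMDiff (cotI n) (cotI n) ∞ (dilation c : CotangentBundle n M → CotangentBundle n M) :=
  contMDiffOn_univ.1 <| contMDiffOn_const_smul_totalSpace
    (f := TotalSpace.proj) (V := TotalSpace.snd) contMDiff_id.contMDiffOn c

/-- `P_c` as a diffeomorphism of `T*M`. -/
def dilationDiffeomorph {c : ℝ} (hc : c ≠ 0) :
    CotangentBundle n M ≃ₘ⟮cotI n, cotI n⟯ CotangentBundle n M where
  toFun := dilation c
  invFun := dilation c⁻¹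
  left_inv := dilation_inv_dilation hc
  right_inv := dilation_dilation_inv hc
  contMDiff_toFun := contMDiff_dilation c
  contMDiff_invFun := contMDiff_dilation c⁻¹

theorem mdifferentiable_dilation (c : ℝ) :
    MDifferentiable (cotI n) (cotI n) (dilation c : CotangentBundle n M → CotangentBundle n M) :=
  (contMDiff_dilation c).mdifferentiable (by simp)

theorem extChartAt_comp_dilation {c : ℝ} (hc : c ≠ 0) (q : CotangentBundle n M) :
    extChartAt (cotI n) q ∘ dilation c =ᶠ[𝓝 q] modelDilation n hc ∘ extChartAt (cotI n) q := by
  let e := trivializationAt (Model n →L[ℝ] ℝ) (fun x : M => TangentSpace (𝓡 n) x →L[ℝ] ℝ) q.proj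
  filter_upwards [(FiberBundle.continuous_proj _ _).continuousAt.eventually_mem
    (e.open_baseSet.mem_nhds (FiberBundle.mem_baseSet_trivializationAt' q.proj))] with r hr
  have hfst : (e (dilation c r)).1 = (e r).1 :=
    (e.coe_fst' (x := dilation c r) hr).trans (e.coe_fst' (x := r) hr).symm
  have hsnd : (e (dilation c r)).2 = c • (e r).2 := (e.linear ℝ hr).map_smul c r.snd
  rw [Function.comp_apply, Function.comp_apply, FiberBundle.extChartAt]
  exact Prod.ext (congrArg (extChartAt (𝓡 n) q.proj) hfst) hsnd

theorem extChartAt_dilation {c : ℝ} (hc : c ≠ 0) (q : CotangentBundle n M) :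
    extChartAt (cotI n) (dilation c q) (dilation c q) =
      modelDilation n hc (extChartAt (cotI n) q q) :=
  (extChartAt_comp_dilation hc q).eq_of_nhds

theorem extChartAt_symm_comp_modelDilation {c : ℝ} (hc : c ≠ 0) (q : CotangentBundle n M) :
    (extChartAt (cotI n) q).symm ∘ modelDilation n hc =ᶠ[𝓝 (extChartAt (cotI n) q q)]
      dilation c ∘ (extChartAt (cotI n) q).symm := by
  have hsymm : Tendsto (extChartAt (cotI n) q).symm (𝓝 (extChartAt (cotI n) q q)) (𝓝 q) := by
    simpa only [ContinuousAt, extChartAt_to_inv] using continuousAt_extChartAt_symm (I := cotI n) q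
  have hmem : ∀ᶠ r in 𝓝 q, dilation c r ∈ (extChartAt (cotI n) q).source :=
    (contMDiff_dilation c).continuous.continuousAt.eventually_mem
      (extChartAt_source_mem_nhds (I := cotI n) (dilation c q))
  filter_upwards [extChartAt_target_mem_nhds q, hsymm.eventually hmem,
    hsymm.eventually (extChartAt_comp_dilation hc q)] with z hz hsource hchart
  rw [Function.comp_apply, Function.comp_apply, (extChartAt (cotI n) q).right_inv hz] at hchart
  rw [Function.comp_apply, ← hchart, (extChartAt (cotI n) q).left_inv hsource, Function.comp_apply]

theorem dchart_apply (q : CotangentBundle n M) (ξ : TangentSpace (cotI n) q) : dchart q ξ = ξ :=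
  DFunLike.congr_fun (hasMFDerivAt_extChartAt_self q).mfderiv ξ

theorem dchart_dilation {c : ℝ} (hc : c ≠ 0) (q : CotangentBundle n M)
    (ξ : TangentSpace (cotI n) q) :
    dchart (dilation c q) (mfderiv (cotI n) (cotI n) (dilation c) q ξ) =
      modelDilation n hc (dchart q ξ) := by
  have hchart : ∀ r : CotangentBundle n M,
      MDifferentiableAt (cotI n) 𝓘(ℝ, CotModel n) (extChartAt (cotI n) r) r :=
    fun r => (hasMFDerivAt_extChartAt_self r).mdifferentiableAt
  have hleft := (hchart (dilation c q)).hasMFDerivAt.comp q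
    (mdifferentiable_dilation c q).hasMFDerivAt
  have hright := (modelDilation n hc).hasMFDerivAt.comp q (hchart q).hasMFDerivAt
  exact DFunLike.congr_fun (hasMFDerivAt_unique hleft
    (hright.congr_of_eventuallyEq (extChartAt_comp_dilation hc q))) ξ

theorem mfderiv_dilation {c : ℝ} (hc : c ≠ 0) (q : CotangentBundle n M)
    (ξ : TangentSpace (cotI n) q) :
    mfderiv (cotI n) (cotI n) (dilation c) q ξ = modelDilation n hc ξ :=
  (dchart_apply _ _).symm.trans <|
    (dchart_dilation hc q ξ).trans (congrArg (modelDilation n hc) (dchart_apply q ξ))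

end Dilation

section Liouville

variable {n : ℕ} {M : Type*} [TopologicalSpace M] [ChartedSpace (Model n) M]
  [IsManifold (𝓡 n) ∞ M]
  {E₁ : Type*} [NormedAddCommGroup E₁] [NormedSpace ℝ E₁] {H₁ : Type*} [TopologicalSpace H₁]
  {I₁ : ModelWithCorners ℝ E₁ H₁} {N : Type*} [TopologicalSpace N] [ChartedSpace H₁ N]

theorem dproj_dilation (c : ℝ) (q : CotangentBundle n M) (ξ : TangentSpace (cotI n) q) :
    dproj (dilation c q) (mfderiv (cotI n) (cotI n) (dilation c) q ξ) = dproj q ξ := by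
  have hproj : MDifferentiable (cotI n) (𝓡 n) fun p : CotangentBundle n M => p.proj :=
    (contMDiff_proj (n := ∞) _).mdifferentiable (by simp)
  exact (mfderiv_comp_apply q (hproj (dilation c q)) (mdifferentiable_dilation c q) ξ).symm

variable (I₁) in
/-- The pull-back `f^*θ` of the Liouville one-form. -/
def liouvillePullback (f : N → CotangentBundle n M) (x : N) : TangentSpace I₁ x →L[ℝ] ℝ :=
  (liouville (f x)).comp (mfderiv I₁ (cotI n) f x)

theorem liouvillePullback_congr {f g : N → CotangentBundle n M} {x : N} (h : f =ᶠ[𝓝 x] g) :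
    liouvillePullback I₁ f x = liouvillePullback I₁ g x := by
  have hcomp : ∀ {q r : CotangentBundle n M} (A : TangentSpace I₁ x →L[ℝ] CotModel n), q = r →
      (liouville q).comp A = (liouville r).comp A := fun A hqr => hqr ▸ rfl
  exact (congrArg (liouville (f x)).comp h.mfderiv_eq).trans (hcomp _ h.eq_of_nhds)

theorem liouvillePullback_comp_diffeomorph {E₂ H₂ N' : Type*} [NormedAddCommGroup E₂]
    [NormedSpace ℝ E₂] [TopologicalSpace H₂] {I₂ : ModelWithCorners ℝ E₂ H₂}
    [TopologicalSpace N'] [ChartedSpace H₂ N'] {k : ℕ∞ω} (f : N → CotangentBundle n M)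
    (e : N' ≃ₘ^k⟮I₂, I₁⟯ N) (hk : k ≠ 0) (x : N') :
    liouvillePullback I₂ (f ∘ e) x =
      (liouvillePullback I₁ f (e x)).comp (mfderiv I₂ I₁ e x) :=
  congrArg (liouville (f (e x))).comp (mfderiv_comp_diffeomorph f e hk x)

theorem liouville_comp_mfderiv_dilation (c : ℝ) (q : CotangentBundle n M) :
    (liouville (dilation c q)).comp (mfderiv (cotI n) (cotI n) (dilation c) q) =
      c • liouville q :=
  ContinuousLinearMap.ext fun ξ => congrArg (c • q.snd) (dproj_dilation c q ξ)

theorem liouvillePullback_dilation_comp {c : ℝ} (hc : c ≠ 0) (f : N → CotangentBundle n M)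
    (x : N) : liouvillePullback I₁ (dilation c ∘ f) x = c • liouvillePullback I₁ f x := by
  have hderiv : mfderiv I₁ (cotI n) (dilation c ∘ f) x =
      (mfderiv (cotI n) (cotI n) (dilation c) (f x)).comp (mfderiv I₁ (cotI n) f x) :=
    mfderiv_diffeomorph_comp (dilationDiffeomorph hc) f (by simp) x
  exact (congrArg (liouville (dilation c (f x))).comp hderiv).trans
    (congrArg (ContinuousLinearMap.comp · (mfderiv I₁ (cotI n) f x))
      (liouville_comp_mfderiv_dilation c (f x)))

theorem liouvilleInChart_modelDilation {c : ℝ} (hc : c ≠ 0) (q : CotangentBundle n M) :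
    ∀ᶠ z in 𝓝 (extChartAt (cotI n) q q), ∀ v : CotModel n,
      liouvilleInChart q (modelDilation n hc z) (modelDilation n hc v) =
        c * liouvilleInChart q z v := by
  let χ := extChartAt (cotI n) q
  filter_upwards [(extChartAt_symm_comp_modelDilation hc q).eventually_nhds] with z hz v
  have hpull := (liouvillePullback_comp_diffeomorph χ.symm (modelDilation n hc).toDiffeomorph
    (by simp) z).symm.trans <|
      (liouvillePullback_congr hz).trans (liouvillePullback_dilation_comp hc χ.symm z)
  rw [(modelDilation n hc).coe_toDiffeomorph, (modelDilation n hc).mfderiv_eq] at hpull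
  exact DFunLike.congr_fun hpull v

theorem sympl_smul_smul (q : CotangentBundle n M) (a b : ℝ) (ξ η : TangentSpace (cotI n) q) :
    sympl q (a • ξ) (b • η) = a * b * sympl q ξ η := by
  have hsmul : ∀ (B : CotModel n →L[ℝ] CotModel n →L[ℝ] ℝ) (s t : ℝ) (u v : CotModel n),
      B (s • u) (t • v) = s * t * B u v := fun B s t u v => by
    rw [(B (s • u)).map_smul, B.map_smul]
    exact (mul_left_comm t s _).trans (mul_assoc s t _).symm
  rw [sympl, (dchart q).map_smul a ξ, (dchart q).map_smul b η, hsmul, hsmul, sympl]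
  ring

theorem sympl_dilation {c : ℝ} (hc : c ≠ 0) (q : CotangentBundle n M)
    (ξ η : TangentSpace (cotI n) q) :
    sympl (dilation c q) (mfderiv (cotI n) (cotI n) (dilation c) q ξ)
      (mfderiv (cotI n) (cotI n) (dilation c) q η) = c * sympl q ξ η := by
  have hfderiv := fderiv_oneForm_comp_equiv (modelDilation n hc) c (liouvilleInChart q) _
    (liouvilleInChart_modelDilation hc q)
  have hchart : liouvilleInChart (dilation c q) = liouvilleInChart q := rfl
  rw [sympl, dchart_dilation hc, dchart_dilation hc, extChartAt_dilation hc, hchart, hfderiv,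
    hfderiv, ← mul_sub, sympl]

end Liouville

namespace SubRiemannianStructure

variable {n : ℕ} {M : Type*} [TopologicalSpace M] [ChartedSpace (Model n) M]
  [IsManifold (𝓡 n) ∞ M] {S : SubRiemannianStructure n M} {c : ℝ}

variable (S) in
theorem hamiltonian_dilation (c : ℝ) (q : CotangentBundle n M) :
    S.hamiltonian (dilation c q) = c ^ 2 * S.hamiltonian q := by
  have hpair : ∀ i, (dilation c q).snd (S.orthonormalBasisAt (dilation c q).proj i) =
      c * q.snd (S.orthonormalBasisAt q.proj i) := fun _ => rfl
  simp only [hamiltonian, hpair, mul_pow, ← Finset.mul_sum]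
  ring

theorem dilation_mem_levelSet {s : ℝ} {q : CotangentBundle n M} (hq : q ∈ S.levelSet s) (c : ℝ) :
    dilation c q ∈ S.levelSet (c ^ 2 * s) :=
  (S.hamiltonian_dilation c q).trans <|
    (congrArg (c ^ 2 * ·) hq).trans (mul_div_assoc (c ^ 2) s 2).symm

theorem mfderiv_hamiltonian_dilation (hc : c ≠ 0) (q : CotangentBundle n M)
    (ξ : TangentSpace (cotI n) q) :
    mfderiv (cotI n) 𝓘(ℝ, ℝ) S.hamiltonian (dilation c q)
        (mfderiv (cotI n) (cotI n) (dilation c) q ξ) =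
      c ^ 2 • mfderiv (cotI n) 𝓘(ℝ, ℝ) S.hamiltonian q ξ := by
  have hscale : mfderiv (cotI n) 𝓘(ℝ, ℝ) (S.hamiltonian ∘ dilation c) q =
      c ^ 2 • mfderiv (cotI n) 𝓘(ℝ, ℝ) S.hamiltonian q := by
    rw [show S.hamiltonian ∘ dilation c = c ^ 2 • S.hamiltonian from
      funext (S.hamiltonian_dilation c)]
    exact mfderiv_const_smul _ _ q
  have hderiv := mfderiv_comp_diffeomorph (I₃ := 𝓘(ℝ, ℝ)) S.hamiltonian (dilationDiffeomorph hc)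
    (by simp) q
  exact DFunLike.congr_fun (hderiv.symm.trans hscale) ξ

theorem IsHamiltonianVector.dilate (hc : c ≠ 0) {q : CotangentBundle n M}
    {v : TangentSpace (cotI n) q} (hv : S.IsHamiltonianVector q v) :
    S.IsHamiltonianVector (dilation c q) (c • mfderiv (cotI n) (cotI n) (dilation c) q v) := by
  intro η
  obtain ⟨ξ, rfl⟩ :=
    ((dilationDiffeomorph hc).mfderivToContinuousLinearEquiv (by simp) q).surjective η
  let P := mfderiv (cotI n) (cotI n) (dilation c) q
  have hsympl : sympl (dilation c q) (P ξ) (c • P v) = c ^ 2 * sympl q ξ v := calc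
    sympl (dilation c q) (P ξ) (c • P v)
      = sympl (dilation c q) ((1 : ℝ) • P ξ) (c • P v) := by rw [one_smul]
    _ = 1 * c * (c * sympl q ξ v) :=
        (sympl_smul_smul _ _ _ _ _).trans (congrArg (1 * c * ·) (sympl_dilation hc q ξ v))
    _ = c ^ 2 * sympl q ξ v := by ring
  exact hsympl.trans <|
    (congrArg (c ^ 2 * ·) (hv ξ)).trans (mfderiv_hamiltonian_dilation hc q ξ).symm

theorem IsExtremalOn.dilate (hc : c ≠ 0) {lam : ℝ → CotangentBundle n M} {J : Set ℝ}
    (h : S.IsExtremalOn lam J) :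
    S.IsExtremalOn (fun t => dilation c (lam (c * t))) {t | c * t ∈ J} := by
  intro t ht
  obtain ⟨v, hlam, hv⟩ := h (c * t) ht
  refine ⟨c • mfderiv (cotI n) (cotI n) (dilation c) (lam (c * t)) v, ?_, hv.dilate hc⟩
  have htime : HasMFDerivAt 𝓘(ℝ, ℝ) 𝓘(ℝ, ℝ) (fun t : ℝ => c * t) t
      (c • ContinuousLinearMap.id ℝ ℝ) :=
    ((hasFDerivAt_id (𝕜 := ℝ) t).const_smul c).hasMFDerivAt
  have hchain := (mdifferentiable_dilation c (lam (c * t))).hasMFDerivAt.comp t (hlam.comp t htime)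
  have hspeed : mfderiv (cotI n) (cotI n) (dilation c) (lam (c * t)) ((c • (1 : ℝ)) • v) =
      c • mfderiv (cotI n) (cotI n) (dilation c) (lam (c * t)) v := by
    rw [smul_eq_mul, mul_one]
    exact (mfderiv (cotI n) (cotI n) (dilation c) (lam (c * t))).map_smul c v
  exact hchain.congr_mfderiv <| ContinuousLinearMap.ext_ring <|
    hspeed.trans (one_smul ℝ _).symm

theorem IsLocalFlow.dilate (hc : c ≠ 0) {δ : ℝ} {U : Set (CotangentBundle n M)}
    {Φ : ℝ → CotangentBundle n M → CotangentBundle n M} (h : S.IsLocalFlow δ U Φ) :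
    S.IsLocalFlow (δ / |c|) (dilation c⁻¹ ⁻¹' U)
      (fun s => dilation c ∘ Φ (c * s) ∘ dilation c⁻¹) := by
  have htime : ∀ s ∈ Ioo (-(δ / |c|)) (δ / |c|), c * s ∈ Ioo (-δ) δ := fun s hs => by
    rw [mem_Ioo, ← abs_lt] at hs ⊢
    rwa [abs_mul, mul_comm, ← lt_div_iff₀ (abs_pos.2 hc)]
  exact
  { pos := div_pos h.pos (abs_pos.2 hc)
    isOpen := h.isOpen.preimage (contMDiff_dilation _).continuous
    map_zero := fun q hq => by
      rw [mul_zero, Function.comp_apply, Function.comp_apply, h.map_zero _ hq,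
        dilation_dilation_inv hc]
    integral := fun q hq t ht => (h.integral _ hq).dilate hc t (htime t ht)
    smooth := by
      have harg : ContMDiff (𝓘(ℝ, ℝ).prod (cotI n)) (𝓘(ℝ, ℝ).prod (cotI n)) ∞
          (fun z : ℝ × CotangentBundle n M => (c * z.1, dilation c⁻¹ z.2)) :=
        ((contDiff_const.mul contDiff_id).contMDiff.comp contMDiff_fst).prodMk
          ((contMDiff_dilation c⁻¹).comp contMDiff_snd)
      exact (contMDiff_dilation c).comp_contMDiffOn
        (h.smooth.comp harg.contMDiffOn fun z hz => ⟨htime _ hz.1, hz.2⟩) }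

theorem HasDot.const_smul {lam : ℝ → CotangentBundle n M}
    {V : ∀ t : ℝ, TangentSpace (cotI n) (lam t)} {t : ℝ} {W : TangentSpace (cotI n) (lam t)}
    (h : S.HasDot lam V t W) (a : ℝ) : S.HasDot lam (fun t => a • V t) t (a • W) := by
  obtain ⟨δ, U, Φ, hΦ, hU, hderiv⟩ := h
  refine ⟨δ, U, Φ, hΦ, hU, ?_⟩
  have hsmul := fun ε => (mfderiv (cotI n) (cotI n) (Φ (-ε)) (lam (t + ε))).map_smul a (V (t + ε))
  simp only [hsmul]
  exact HasDerivAt.const_smul (F := CotModel n) a hderiv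

theorem HasDot.dilate (hc : c ≠ 0) {lam : ℝ → CotangentBundle n M}
    {V : ∀ t : ℝ, TangentSpace (cotI n) (lam t)} {t : ℝ} {W : TangentSpace (cotI n) (lam (c * t))}
    (h : S.HasDot lam V (c * t) W) :
    S.HasDot (fun t => dilation c (lam (c * t)))
      (fun t => mfderiv (cotI n) (cotI n) (dilation c) (lam (c * t)) (V (c * t))) t
      (c • mfderiv (cotI n) (cotI n) (dilation c) (lam (c * t)) W) := by
  obtain ⟨δ, U, Φ, hΦ, hU, hderiv⟩ := h
  refine ⟨δ / |c|, _, _, hΦ.dilate hc, by rwa [mem_preimage, dilation_inv_dilation hc], ?_⟩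
  let G : ℝ → CotModel n := fun ε =>
    mfderiv (cotI n) (cotI n) (Φ (-ε)) (lam (c * t + ε)) (V (c * t + ε))
  have hconj : ∀ ε, (mfderiv (cotI n) (cotI n) (dilation c ∘ Φ (c * -ε) ∘ dilation c⁻¹)
      (dilation c (lam (c * (t + ε))))
      (mfderiv (cotI n) (cotI n) (dilation c) (lam (c * (t + ε))) (V (c * (t + ε)))) : CotModel n) =
        modelDilation n hc (G (c * ε)) := fun ε => by
    rw [mul_neg, mul_add]
    exact (DFunLike.congr_fun (mfderiv_conj_diffeomorph (dilationDiffeomorph hc) (Φ (-(c * ε)))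
      (by simp) (lam (c * t + c * ε))) (V (c * t + c * ε))).trans (mfderiv_dilation hc _ _)
  have hG : HasDerivAt G W (c * 0) := by rwa [mul_zero]
  have hGc := hG.scomp (0 : ℝ) (hasDerivAt_const_mul c)
  have hLG := (modelDilation n hc).hasFDerivAt.comp_hasDerivAt (0 : ℝ) hGc
  refine (hLG.congr_deriv ?_).congr_of_eventuallyEq (Eventually.of_forall hconj)
  exact ((modelDilation n hc).map_smul c W).trans (congrArg (c • ·) (mfderiv_dilation hc _ W).symm)

end SubRiemannianStructure

section Flag

variable {n : ℕ} {M : Type*} [TopologicalSpace M] [ChartedSpace (Model n) M]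
  {T X : ∀ x : M, TangentSpace (𝓡 n) x} {γ : ℝ → M} {c : ℝ}

theorem eventually_extends_velocity_comp_mul (hc : c ≠ 0) (t : ℝ) :
    (∀ᶠ s in 𝓝 t, (c • T) (γ (c * s)) =
        mfderiv 𝓘(ℝ, ℝ) (𝓡 n) (fun r => γ (c * r)) s (1 : ℝ)) ↔
      ∀ᶠ s in 𝓝 (c * t), T (γ s) = mfderiv 𝓘(ℝ, ℝ) (𝓡 n) γ s (1 : ℝ) := by
  rw [← show map (c * ·) (𝓝 t) = 𝓝 (c * t) from (Homeomorph.mulLeft₀ c hc).map_nhds_eq t,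
    eventually_map]
  refine eventually_congr (Eventually.of_forall fun s => ?_)
  rw [mfderiv_comp_mul_left γ hc s]
  exact (IsUnit.mk0 c hc).smul_left_cancel

variable [IsManifold (𝓡 n) ∞ M]

theorem IsSectionOf.const_smul {D : ∀ x : M, Submodule ℝ (TangentSpace (𝓡 n) x)}
    (hT : IsSectionOf D T) (a : ℝ) : IsSectionOf D (a • T) :=
  ⟨hT.1.const_smul_section, fun x => (D x).smul_mem a (hT.2 x)⟩

theorem contMDiff_iterate_mlieBracket
    (hT : ContMDiff (𝓡 n) (𝓡 n).tangent ∞ (fun x => (⟨x, T x⟩ : TangentBundle (𝓡 n) M)))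
    (hX : ContMDiff (𝓡 n) (𝓡 n).tangent ∞ (fun x => (⟨x, X x⟩ : TangentBundle (𝓡 n) M)))
    (j : ℕ) :
    ContMDiff (𝓡 n) (𝓡 n).tangent ∞ (fun x =>
      (⟨x, ((fun Y => VectorField.mlieBracket (𝓡 n) T Y)^[j] X) x⟩ : TangentBundle (𝓡 n) M)) := by
  have hmin : ∀ k : ℕ∞ω, minSmoothness ℝ k = k := fun _ => minSmoothness_of_isRCLikeNormedField
  have : IsManifold (𝓡 n) (minSmoothness ℝ 2) M := by rw [hmin]; infer_instance
  have : IsManifold (𝓡 n) ((⊤ : ℕ∞) + 1) M := inferInstanceAs (IsManifold (𝓡 n) ∞ M)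
  induction j with
  | zero => exact hX
  | succ j ih =>
    rw [Function.iterate_succ_apply']
    exact ContDiff.mlieBracket_vectorField (m := ⊤) (n := ⊤) hT ih
      (by rw [hmin]; rfl)

theorem iterate_mlieBracket_const_smul
    (hT : ContMDiff (𝓡 n) (𝓡 n).tangent ∞ (fun x => (⟨x, T x⟩ : TangentBundle (𝓡 n) M)))
    (hX : ContMDiff (𝓡 n) (𝓡 n).tangent ∞ (fun x => (⟨x, X x⟩ : TangentBundle (𝓡 n) M)))
    (a : ℝ) (j : ℕ) :
    (fun Y => VectorField.mlieBracket (𝓡 n) (a • T) Y)^[j] X =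
      a ^ j • ((fun Y => VectorField.mlieBracket (𝓡 n) T Y)^[j] X) := by
  induction j with
  | zero => rw [pow_zero, one_smul, Function.iterate_zero, Function.iterate_zero]
  | succ j ih =>
    rw [Function.iterate_succ_apply', Function.iterate_succ_apply', ih]
    funext x
    rw [VectorField.mlieBracket_const_smul_left ((hT x).mdifferentiableAt (by simp)),
      VectorField.mlieBracket_const_smul_right
        ((contMDiff_iterate_mlieBracket hT hX j x).mdifferentiableAt (by simp)),
      smul_smul, pow_succ']
    rfl

namespace SubRiemannianStructure

variable {S : SubRiemannianStructure n M} {J : Set ℝ}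

variable (S) in
theorem flag_comp_mul (hc : c ≠ 0) (γ : ℝ → M) (t : ℝ) (i : ℕ) :
    S.flag (fun s => γ (c * s)) t i = S.flag γ (c * t) i := by
  refine le_antisymm (Submodule.span_le.2 ?_) (Submodule.span_le.2 ?_)
  · rintro _ ⟨T, X, hT, hX, hTγ, j, hj, rfl⟩
    obtain ⟨T, rfl⟩ : ∃ T', T = c • T' := ⟨c⁻¹ • T, (smul_inv_smul₀ hc T).symm⟩
    have hT' : IsSectionOf S.D T := inv_smul_smul₀ hc T ▸ hT.const_smul c⁻¹
    rw [iterate_mlieBracket_const_smul hT'.1 hX.1]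
    exact Submodule.smul_mem _ (c ^ j) <| Submodule.subset_span
      ⟨T, X, hT', hX, (eventually_extends_velocity_comp_mul hc t).1 hTγ, j, hj, rfl⟩
  · rintro _ ⟨T, X, hT, hX, hTγ, j, hj, rfl⟩
    refine (Submodule.smul_mem_iff _ (pow_ne_zero j hc)).1 <| Submodule.subset_span
      ⟨c • T, X, hT.const_smul c, hX, (eventually_extends_velocity_comp_mul hc t).2 hTγ, j, hj, ?_⟩
    rw [iterate_mlieBracket_const_smul hT.1 hX.1]
    rfl

variable (S) in
theorem finrank_flag_comp_mul (hc : c ≠ 0) (γ : ℝ → M) (t : ℝ) (i : ℕ) :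
    Module.finrank ℝ (S.flag (fun s => γ (c * s)) t i) =
      Module.finrank ℝ (S.flag γ (c * t) i) :=
  congrArg (fun F : Submodule ℝ (TangentSpace (𝓡 n) (γ (c * t))) => Module.finrank ℝ F)
    (S.flag_comp_mul hc γ t i)

theorem IsAmple.comp_mul (h : S.IsAmple γ J) (hc : c ≠ 0) :
    S.IsAmple (fun t => γ (c * t)) {t | c * t ∈ J} := fun t ht => by
  simpa only [S.finrank_flag_comp_mul hc] using h _ ht

theorem IsEquiregular.comp_mul (h : S.IsEquiregular γ J) (hc : c ≠ 0) :
    S.IsEquiregular (fun t => γ (c * t)) {t | c * t ∈ J} := fun i hi s hs t ht => by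
  simpa only [S.finrank_flag_comp_mul hc] using h i hi _ hs _ ht

theorem HasYoungDiagram.comp_mul {y : YoungDiagram} (h : S.HasYoungDiagram γ J y) (hc : c ≠ 0) :
    S.HasYoungDiagram (fun t => γ (c * t)) {t | c * t ∈ J} y := fun t ht i => by
  simpa only [S.finrank_flag_comp_mul hc] using h _ ht i

end SubRiemannianStructure

end Flag

section LinearAlgebra

theorem linearIndependent_and_span_smul_map {K ι V W : Type*} [Field K] [AddCommGroup V]
    [Module K V] [AddCommGroup W] [Module K W] (L : V ≃ₗ[K] W) {w : ι → K} (hw : ∀ i, w i ≠ 0)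
    {f : ι → V} (hf : LinearIndependent K f) (hspan : Submodule.span K (range f) = ⊤) :
    LinearIndependent K (fun i => w i • L (f i)) ∧
      Submodule.span K (range fun i => w i • L (f i)) = ⊤ := by
  let b := ((Module.Basis.mk hf hspan.ge).map L).unitsSMul fun i => Units.mk0 (w i) (hw i)
  have hb : ⇑b = fun i => w i • L (f i) := funext fun i => by
    rw [Module.Basis.unitsSMul_apply, Module.Basis.map_apply, Module.Basis.mk_apply,
      Units.smul_mk0]
  exact hb ▸ ⟨b.linearIndependent, b.span_eq⟩

theorem zpow_smul_map_sum {K ι V W : Type*} [Field K] [Fintype ι] [AddCommGroup V] [Module K V]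
    [TopologicalSpace V] [AddCommGroup W] [Module K W] [TopologicalSpace W] {c : K} (hc : c ≠ 0)
    (L : V →L[K] W) (m : ℕ) (d : ι → ℕ) (r : ι → K) (e : ι → V) :
    c ^ ((m : ℤ) - 1) • c • L (∑ q, r q • e q) =
      ∑ q, (c ^ (m + d q) * r q) • c ^ (-(d q : ℤ)) • L (e q) := by
  rw [smul_smul, ← zpow_add_one₀ hc, sub_add_cancel, map_sum, Finset.smul_sum]
  refine Finset.sum_congr rfl fun q _ => ?_
  rw [map_smul, smul_smul, smul_smul, mul_right_comm, ← zpow_natCast, ← zpow_add₀ hc,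
    Nat.cast_add, add_neg_cancel_right]

end LinearAlgebra

theorem IsNormal.dilate {y : YoungDiagram} {R : Matrix (Box y) (Box y) ℝ} (h : IsNormal R)
    (c : ℝ) : IsNormal (fun p q => c ^ (p.col + q.col) * R p q : Matrix (Box y) (Box y) ℝ) where
  symm p q := by rw [h.symm p q, add_comm]
  skew p q p' q' hlen hcol hp hq hp' hq' := by
    rw [h.skew p q p' q' hlen hcol hp hq hp' hq', hp', hq', hcol, mul_neg]
  vanish_eq p q hlen hR := h.vanish_eq p q hlen (right_ne_zero_of_mul hR)
  vanish_gt p q hlen hR := h.vanish_gt p q hlen (right_ne_zero_of_mul hR)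

section Frame

variable {n : ℕ} {M : Type*} [TopologicalSpace M] [ChartedSpace (Model n) M]
  [IsManifold (𝓡 n) ∞ M] {c : ℝ} {lam : ℝ → CotangentBundle n M} {J : Set ℝ}

/-- The vector field `t ↦ a (P_c)_* V(ct)` along the curve `t ↦ c λ(ct)`, for a vector field `V`
along `λ`; canonical frames are transported by `P_c` in this form, the factor `a` being a power of
`c`. -/
abbrev dilateField (c a : ℝ) (V : ∀ t, TangentSpace (cotI n) (lam t)) (t : ℝ) :
    TangentSpace (cotI n) (dilation c (lam (c * t))) :=
  a • mfderiv (cotI n) (cotI n) (dilation c) (lam (c * t)) (V (c * t))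

theorem contMDiffOn_dilateField {V : ∀ t, TangentSpace (cotI n) (lam t)}
    (hV : ContMDiffOn 𝓘(ℝ, ℝ) (cotI n).tangent ∞
      (fun t => (⟨lam t, V t⟩ : TangentBundle (cotI n) (CotangentBundle n M))) J) (c a : ℝ) :
    ContMDiffOn 𝓘(ℝ, ℝ) (cotI n).tangent ∞
      (fun t => (⟨dilation c (lam (c * t)), dilateField c a V t⟩ :
        TangentBundle (cotI n) (CotangentBundle n M))) {t | c * t ∈ J} := by
  have htime : ContMDiff 𝓘(ℝ, ℝ) 𝓘(ℝ, ℝ) ∞ (fun t : ℝ => c * t) :=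
    (contDiff_const.mul contDiff_id).contMDiff
  have htangent := (contMDiff_dilation (n := n) (M := M) c).contMDiff_tangentMap (m := ∞) le_rfl
  exact contMDiffOn_const_smul_totalSpace
    (htangent.comp_contMDiffOn (hV.comp htime.contMDiffOn fun t ht => ht)) a

theorem sympl_dilateField (hc : c ≠ 0) (a b : ℝ) (V W : ∀ t, TangentSpace (cotI n) (lam t))
    (t : ℝ) :
    sympl (dilation c (lam (c * t))) (dilateField c a V t) (dilateField c b W t) =
      a * b * (c * sympl (lam (c * t)) (V (c * t)) (W (c * t))) :=
  (sympl_smul_smul _ a b _ _).trans (congrArg (a * b * ·) (sympl_dilation hc _ _ _))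

theorem dproj_dilateField {V : ∀ t, TangentSpace (cotI n) (lam t)} {t : ℝ}
    (hV : dproj (lam (c * t)) (V (c * t)) = 0) (a : ℝ) :
    dproj (dilation c (lam (c * t))) (dilateField c a V t) = 0 :=
  ((dproj (dilation c (lam (c * t)))).map_smul a _).trans <|
    (congrArg (a • ·) ((dproj_dilation c _ _).trans hV)).trans (smul_zero (A := Model n) a)

theorem linearIndependent_and_span_dilateField {ι : Type*} (hc : c ≠ 0)
    {V : ι → ∀ t, TangentSpace (cotI n) (lam t)} {w : ι → ℝ} (hw : ∀ i, w i ≠ 0) {t : ℝ}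
    (hV : LinearIndependent ℝ (fun i => V i (c * t)))
    (hspan : Submodule.span ℝ (range fun i => V i (c * t)) = ⊤) :
    LinearIndependent ℝ (fun i => dilateField c (w i) (V i) t) ∧
      Submodule.span ℝ (range fun i => dilateField c (w i) (V i) t) = ⊤ :=
  linearIndependent_and_span_smul_map
    ((dilationDiffeomorph hc).mfderivToContinuousLinearEquiv (by simp) _).toLinearEquiv hw hV hspan

namespace IsCanonicalFrame

variable {S : SubRiemannianStructure n M} {y : YoungDiagram} {q₀ : CotangentBundle n M}
  {E F : Box y → ∀ t : ℝ, TangentSpace (cotI n) (lam t)} {R : ℝ → Matrix (Box y) (Box y) ℝ}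

theorem hasDot_dilateField_E (h : IsCanonicalFrame S q₀ J lam y E F R) (hc : c ≠ 0)
    {p p' : Box y} (hrow : p'.row = p.row) (hcol : p.col = p'.col + 1) {t : ℝ} (ht : c * t ∈ J) :
    S.HasDot (fun t => dilation c (lam (c * t))) (dilateField c (c ^ (-(p.col : ℤ))) (E p)) t
      (dilateField c (c ^ (-(p'.col : ℤ))) (E p') t) := by
  have hdot := ((h.dot_E p p' hrow hcol _ ht).dilate hc).const_smul (c ^ (-(p.col : ℤ)))
  have hexp : c ^ (-(p.col : ℤ)) * c = c ^ (-(p'.col : ℤ)) := by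
    rw [← zpow_add_one₀ hc, hcol, Nat.cast_add_one, neg_add', sub_add_cancel]
  rwa [smul_smul, hexp] at hdot

theorem hasDot_dilateField_E_one (h : IsCanonicalFrame S q₀ J lam y E F R) (hc : c ≠ 0)
    {p : Box y} (hcol : p.col = 1) {t : ℝ} (ht : c * t ∈ J) :
    S.HasDot (fun t => dilation c (lam (c * t))) (dilateField c (c ^ (-(p.col : ℤ))) (E p)) t
      (-dilateField c (c ^ ((p.col : ℤ) - 1)) (F p) t) := by
  have hdot := ((h.dot_E_one p hcol _ ht).dilate hc).const_smul (c ^ (-(p.col : ℤ)))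
  have hexp : c ^ (-(p.col : ℤ)) * c = c ^ ((p.col : ℤ) - 1) := by
    rw [← zpow_add_one₀ hc, hcol, Nat.cast_one, neg_add_cancel, sub_self]
  rwa [ContinuousLinearMap.map_neg, smul_neg, smul_neg, smul_smul, hexp] at hdot

theorem hasDot_dilateField_F (h : IsCanonicalFrame S q₀ J lam y E F R) (hc : c ≠ 0)
    {p p' : Box y} (hrow : p'.row = p.row) (hcol : p'.col = p.col + 1) {t : ℝ} (ht : c * t ∈ J) :
    S.HasDot (fun t => dilation c (lam (c * t))) (dilateField c (c ^ ((p.col : ℤ) - 1)) (F p)) t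
      ((∑ q, (c ^ (p.col + q.col) * R (c * t) p q) •
          dilateField c (c ^ (-(q.col : ℤ))) (E q) t) -
        dilateField c (c ^ ((p'.col : ℤ) - 1)) (F p') t) := by
  have hdot := ((h.dot_F p p' hrow hcol _ ht).dilate hc).const_smul (c ^ ((p.col : ℤ) - 1))
  have hexp : c ^ ((p.col : ℤ) - 1) * c = c ^ ((p'.col : ℤ) - 1) := by
    rw [← zpow_add_one₀ hc, hcol, Nat.cast_add_one, sub_add_cancel, add_sub_cancel_right]
  rwa [ContinuousLinearMap.map_sub, smul_sub, smul_sub, zpow_smul_map_sum hc _ _ Box.col, smul_smul,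
    hexp] at hdot

theorem hasDot_dilateField_F_last (h : IsCanonicalFrame S q₀ J lam y E F R) (hc : c ≠ 0)
    {p : Box y} (hcol : p.col = p.len) {t : ℝ} (ht : c * t ∈ J) :
    S.HasDot (fun t => dilation c (lam (c * t))) (dilateField c (c ^ ((p.col : ℤ) - 1)) (F p)) t
      (∑ q, (c ^ (p.col + q.col) * R (c * t) p q) •
        dilateField c (c ^ (-(q.col : ℤ))) (E q) t) := by
  have hdot := ((h.dot_F_last p hcol _ ht).dilate hc).const_smul (c ^ ((p.col : ℤ) - 1))
  rwa [zpow_smul_map_sum hc _ _ Box.col] at hdot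

theorem linearIndependent_and_span_sumElim_dilateField
    (h : IsCanonicalFrame S q₀ J lam y E F R) (hc : c ≠ 0) {t : ℝ} (ht : c * t ∈ J) :
    let frame := Sum.elim (fun p => dilateField c (c ^ (-(p.col : ℤ))) (E p) t)
      (fun p => dilateField c (c ^ ((p.col : ℤ) - 1)) (F p) t)
    LinearIndependent ℝ frame ∧ Submodule.span ℝ (range frame) = ⊤ := by
  intro frame
  have hEF : (fun i => Sum.elim E F i (c * t)) =
      Sum.elim (fun p => E p (c * t)) (fun p => F p (c * t)) :=
    funext <| Sum.rec (fun _ => rfl) fun _ => rfl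
  let w : Box y ⊕ Box y → ℝ :=
    Sum.elim (fun p => c ^ (-(p.col : ℤ))) (fun p => c ^ ((p.col : ℤ) - 1))
  have hw : ∀ i, w i ≠ 0 := Sum.rec (fun _ => zpow_ne_zero _ hc) fun _ => zpow_ne_zero _ hc
  have hframe : frame = fun i => dilateField c (w i) (Sum.elim E F i) t :=
    funext <| Sum.rec (fun _ => rfl) fun _ => rfl
  exact hframe ▸ linearIndependent_and_span_dilateField hc hw
    (hEF ▸ h.linearIndependent _ ht) (hEF ▸ h.span_eq_top _ ht)

theorem dilate (h : IsCanonicalFrame S q₀ J lam y E F R) (hc : c ≠ 0) :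
    IsCanonicalFrame S (dilation c q₀) {t : ℝ | c * t ∈ J} (fun t => dilation c (lam (c * t))) y
      (fun p => dilateField c (c ^ (-(p.col : ℤ))) (E p))
      (fun p => dilateField c (c ^ ((p.col : ℤ) - 1)) (F p))
      (fun t p q => c ^ (p.col + q.col) * R (c * t) p q) where
  isOpen := h.isOpen.preimage (continuous_const_mul c)
  ordConnected := by
    have hconvex : Convex ℝ J := convex_iff_ordConnected.2 h.ordConnected
    exact (hconvex.linear_preimage (LinearMap.mulLeft ℝ c)).ordConnected
  zero_mem := show c * 0 ∈ J from (mul_zero c).symm ▸ h.zero_mem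
  initial := by rw [mul_zero, h.initial]
  extremal := h.extremal.dilate hc
  ample := h.ample.comp_mul hc
  equiregular := h.equiregular.comp_mul hc
  young := h.young.comp_mul hc
  smooth_E p := contMDiffOn_dilateField (h.smooth_E p) c _
  smooth_F p := contMDiffOn_dilateField (h.smooth_F p) c _
  linearIndependent _ ht := (h.linearIndependent_and_span_sumElim_dilateField hc ht).1
  span_eq_top _ ht := (h.linearIndependent_and_span_sumElim_dilateField hc ht).2
  vertical p _ ht := dproj_dilateField (h.vertical p _ ht) _
  darboux_EE p q t ht := by
    rw [sympl_dilateField hc, h.darboux_EE p q _ ht, mul_zero, mul_zero]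
  darboux_FF p q t ht := by
    rw [sympl_dilateField hc, h.darboux_FF p q _ ht, mul_zero, mul_zero]
  darboux_EF p q t ht := by
    rw [sympl_dilateField hc, h.darboux_EF p q _ ht]
    split_ifs with hpq
    · rw [hpq, mul_one, ← zpow_add₀ hc, ← zpow_add_one₀ hc, add_assoc, sub_add_cancel,
        neg_add_cancel, zpow_zero]
    · rw [mul_zero, mul_zero]
  dot_E _ _ hrow hcol _ ht := h.hasDot_dilateField_E hc hrow hcol ht
  dot_E_one _ hcol _ ht := h.hasDot_dilateField_E_one hc hcol ht
  dot_F _ _ hrow hcol _ ht := h.hasDot_dilateField_F hc hrow hcol ht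
  dot_F_last _ hcol _ ht := h.hasDot_dilateField_F_last hc hcol ht
  smooth_R p q := contDiffOn_const.mul <|
    (h.smooth_R p q).comp (contDiff_const.mul contDiff_id).contDiffOn fun _ ht => ht
  normal _ ht := (h.normal _ ht).dilate c

end IsCanonicalFrame

end Frame

end SubRiem

end

theorem propositionp_general {n : ℕ} {M : Type*} [TopologicalSpace M]
    [ChartedSpace (SubRiem.Model n) M] [IsManifold (𝓡 n) ∞ M]
    (S : SubRiem.SubRiemannianStructure n M) {s : ℝ}
    (q₀ : SubRiem.CotangentBundle n M) (hq₀ : q₀ ∈ S.levelSet s)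
    (J : Set ℝ) (lam : ℝ → SubRiem.CotangentBundle n M) (y : YoungDiagram)
    (E F : SubRiem.Box y → ∀ t : ℝ, TangentSpace (SubRiem.cotI n) (lam t))
    (R : ℝ → Matrix (SubRiem.Box y) (SubRiem.Box y) ℝ)
    (hcan : SubRiem.IsCanonicalFrame S q₀ J lam y E F R)
    (c : ℝ) (hc : c ≠ 0) :
    SubRiem.dilation c q₀ ∈ S.levelSet (c ^ 2 * s) ∧
    SubRiem.IsCanonicalFrame S (SubRiem.dilation c q₀) {t : ℝ | c * t ∈ J}
      (fun t => SubRiem.dilation c (lam (c * t))) y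
      (fun p t => c ^ (-(p.col : ℤ)) •
        mfderiv (SubRiem.cotI n) (SubRiem.cotI n) (SubRiem.dilation c) (lam (c * t)) (E p (c * t)))
      (fun p t => c ^ ((p.col : ℤ) - 1) •
        mfderiv (SubRiem.cotI n) (SubRiem.cotI n) (SubRiem.dilation c) (lam (c * t)) (F p (c * t)))
      (fun t p q => c ^ (p.col + q.col) * R (c * t) p q) :=
  ⟨SubRiem.SubRiemannianStructure.dilation_mem_levelSet hq₀ c, hcan.dilate hc⟩

theorem propositionp {n : ℕ} {M : Type*} [TopologicalSpace M] [T2Space M]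
    [SecondCountableTopology M] [ChartedSpace (SubRiem.Model n) M] [IsManifold (𝓡 n) ∞ M]
    (S : SubRiem.SubRiemannianStructure n M)
    (q₀ : SubRiem.CotangentBundle n M) (hq₀ : q₀ ∈ S.levelSet 1)
    (J : Set ℝ) (lam : ℝ → SubRiem.CotangentBundle n M) (y : YoungDiagram)
    (E F : SubRiem.Box y → ∀ t : ℝ, TangentSpace (SubRiem.cotI n) (lam t))
    (R : ℝ → Matrix (SubRiem.Box y) (SubRiem.Box y) ℝ)
    (hcan : SubRiem.IsCanonicalFrame S q₀ J lam y E F R)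
    (c : ℝ) (hc : 0 < c) :
    SubRiem.dilation c q₀ ∈ S.levelSet (c ^ 2) ∧
    SubRiem.IsCanonicalFrame S (SubRiem.dilation c q₀) {t : ℝ | c * t ∈ J}
      (fun t => SubRiem.dilation c (lam (c * t))) y
      (fun p t => c ^ (-(p.col : ℤ)) •
        mfderiv (SubRiem.cotI n) (SubRiem.cotI n) (SubRiem.dilation c) (lam (c * t)) (E p (c * t)))
      (fun p t => c ^ ((p.col : ℤ) - 1) •
        mfderiv (SubRiem.cotI n) (SubRiem.cotI n) (SubRiem.dilation c) (lam (c * t)) (F p (c * t)))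
      (fun t p q => c ^ (p.col + q.col) * R (c * t) p q) := by
  simpa only [mul_one] using propositionp_general S q₀ hq₀ J lam y E F R hcan c hc.ne'
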